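/- For an integer $r\ge 1$, an $r$-graph $G$ consists of a finite vertex set $V$ and a set $E(G)$ of $r$-element subsets of $V$, called edges. A clique of order $k$ in $G$ is a set of $k$ vertices all of whose $r$-element subsets are edges of $G$. For $x\in\mathbb{R}^V$ put $$\lambda(G,x)=\sum_{e\in E(G)}\ \prod_{i\in e}x_i ,$$ and let the Lagrangian $\lambda(G)$ be the maximum of $\lambda(G,x)$ over all $x\in\mathbb{R}^V$ with $x_i\ge 0$ for every $i\in V$ and $\sum_{i\in V}x_i=1$. Let $[n]^{(r)}$ denote the complete $r$-graph on the vertex set $[n]=\{1,\dots,n\}$. **Theorem.** Let $m$ and $t$ be nonnegative integers satisfying $$\binom{t-1}{3}\ \le\ m\ \le\ \binom{t-1}{3}+\binom{t-2}{2}-\frac{1}{2}(t-1),$$ where $\binom{n}{k}=0$ if $n<k$. Let $G$ be a $3$-graph with $m$ edges that contains no clique of order $t-1$. Then $$\lambda(G)<\lambda\big([t-1]^{(3)}\big).$$ -/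

import Mathlib

/-- An `r`-uniform hypergraph (`r`-graph) on the vertex set `V`: a family of `r`-element subsets
of `V`. -/
structure RGraph (r : ℕ) (V : Type*) where
  /-- The edge set. -/
  edges : Finset (Finset V)
  /-- Every edge has exactly `r` vertices. -/
  card_of_mem : ∀ e ∈ edges, e.card = r

namespace RGraph

/-- The complete `r`-graph on the vertex set `V`; `[n]^{(r)}` is `complete r (Fin n)`. -/
def complete (r : ℕ) (V : Type*) [Fintype V] : RGraph r V where
  edges := Finset.powersetCard r Finset.univ
  card_of_mem _ he := (Finset.mem_powersetCard.mp he).2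

/-- `G` contains a clique of order `k`: there are `k` vertices all of whose `r`-subsets are edges
of `G`. -/
def ContainsClique {r : ℕ} {V : Type*} (G : RGraph r V) (k : ℕ) : Prop :=
  ∃ S : Finset V, S.card = k ∧ ∀ e : Finset V, e ⊆ S → e.card = r → e ∈ G.edges

/-- The polynomial `λ(G, x) = ∑_{e ∈ E(G)} ∏_{i ∈ e} x_i`. -/
def weight {r : ℕ} {V : Type*} (G : RGraph r V) (x : V → ℝ) : ℝ :=
  ∑ e ∈ G.edges, ∏ i ∈ e, x i

/-- The Lagrangian `λ(G)`: the maximum of `λ(G, x)` over the standard simplex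
`{x | x_i ≥ 0, ∑ x_i = 1}`. The supremum is attained, see `lagrangian_isGreatest`. -/
noncomputable def lagrangian {r : ℕ} {V : Type*} [Fintype V] (G : RGraph r V) : ℝ :=
  sSup (G.weight '' stdSimplex ℝ V)

theorem lagrangian_isGreatest {r : ℕ} {V : Type*} [Fintype V] [Nonempty V] (G : RGraph r V) :
    IsGreatest (G.weight '' stdSimplex ℝ V) G.lagrangian := by
  classical
  have hc : Continuous G.weight := by
    unfold weight
    fun_prop
  have hne : (stdSimplex ℝ V).Nonempty :=
    ⟨_, single_mem_stdSimplex ℝ (Classical.arbitrary V)⟩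
  exact ((isCompact_stdSimplex ℝ V).image hc).isGreatest_sSup (hne.image _)

end RGraph

/-! Put n = t - 1. The upper bound on m says |E| ≤ C(n+1,3) - (3n-2)/2, which is `Sparse n`.
Restrict an optimal weighting to its support, of size k. If k < n, the weight is strictly below
λ([n]^(3)), since spreading weight onto an unused vertex helps. If k = n, some triple of the support
is missing, as there is no clique of order n. What remains is to exclude k > n for weights at least
λ([n]^(3)): `Extremal.false`.

There (E, x) may be taken optimal among all sparse families and weightings on k vertices, so all
link weights agree. Let a, c be the two lightest vertices and u the largest weight. Trading edges
through both a and c for missing triples loses nothing, so every triple containing a neighbour of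
the pair may be assumed to be an edge (`exists_pairClosed`); sparsity then leaves the pair at most n
- 4 neighbours. Moving the weight of c onto a costs only a second-order term.

If k ≥ n + 2, the edges at c can then be respent among the n + 1 heaviest vertices
(`degree_mul_le`); optimality forces the tail of x to be light and u ≥ 1/(n-1). If k = n + 1,
comparison with the complete graph on n + 1 vertices (`critical_count`) puts the four lightest
weights well below u. Both contradict `Extremal.cap`, which bounds 2u - 2u² + ∑ x_i² by its value at
the uniform weighting on n vertices. -/

open Finset

/-- The sum over the sets in `E` of the products of the weights `x`. -/
def edgeWeight {α : Type*} (E : Finset (Finset α)) (x : α → ℝ) : ℝ :=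
  ∑ e ∈ E, ∏ i ∈ e, x i

/-- The elementary symmetric sum of degree `j` of the weights `x` over the set `s`. -/
def esum {α : Type*} (j : ℕ) (s : Finset α) (x : α → ℝ) : ℝ :=
  edgeWeight (powersetCard j s) x

/-! ### Elementary symmetric sums -/

section Symmetric

variable {α β : Type*}

theorem edgeWeight_mono {E F : Finset (Finset α)} {x : α → ℝ} (h : E ⊆ F) (hx : ∀ i, 0 ≤ x i) :
    edgeWeight E x ≤ edgeWeight F x :=
  sum_le_sum_of_subset_of_nonneg h fun _ _ _ => prod_nonneg fun i _ => hx i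

theorem esum_one (s : Finset α) (x : α → ℝ) : esum 1 s x = ∑ i ∈ s, x i := by
  simp [esum, edgeWeight, powersetCard_one]

theorem esum_empty (j : ℕ) (x : α → ℝ) : esum (j + 1) ∅ x = 0 := by
  rw [esum, powersetCard_eq_empty.2 (by simp), edgeWeight, sum_empty]

theorem esum_insert [DecidableEq α] (j : ℕ) {a : α} {s : Finset α} (ha : a ∉ s) (x : α → ℝ) :
    esum (j + 1) (insert a s) x = esum (j + 1) s x + x a * esum j s x := by
  have hmem : ∀ f ∈ powersetCard j s, a ∉ f := fun f hf h => ha ((mem_powersetCard.1 hf).1 h)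
  unfold esum edgeWeight
  rw [powersetCard_succ_insert ha, sum_union, sum_image, mul_sum]
  · congr 1
    exact sum_congr rfl fun f hf => prod_insert (hmem f hf)
  · intro f hf g hg h
    rw [← erase_insert (hmem f hf), ← erase_insert (hmem g hg), h]
  · rw [disjoint_left]
    intro f hf hf'
    obtain ⟨g, -, rfl⟩ := mem_image.1 hf'
    exact ha ((mem_powersetCard.1 hf).1 (mem_insert_self _ _))

theorem two_mul_esum_two (s : Finset α) (x : α → ℝ) :
    2 * esum 2 s x = (∑ i ∈ s, x i) ^ 2 - ∑ i ∈ s, x i ^ 2 := by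
  classical
  induction s using Finset.induction_on with
  | empty => simp [esum_empty]
  | insert a s ha ih =>
    rw [esum_insert 1 ha, esum_one, sum_insert ha, sum_insert ha, mul_add, ih]
    ring

theorem esum_congr {j : ℕ} {s : Finset α} {x y : α → ℝ} (h : ∀ i ∈ s, x i = y i) :
    esum j s x = esum j s y :=
  sum_congr rfl fun _ hf => prod_congr rfl fun i hi => h i ((mem_powersetCard.1 hf).1 hi)

theorem esum_map (j : ℕ) (s : Finset α) (g : α ↪ β) (x : β → ℝ) :
    esum j (s.map g) x = esum j s (x ∘ g) := by
  simp [esum, edgeWeight, powersetCard_map, sum_map]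

theorem esum_mono {j : ℕ} {s t : Finset α} (h : s ⊆ t) {x : α → ℝ} (hx : ∀ i, 0 ≤ x i) :
    esum j s x ≤ esum j t x :=
  edgeWeight_mono (powersetCard_mono h) hx

theorem esum_const (j : ℕ) (s : Finset α) (c : ℝ) :
    esum j s (fun _ => c) = (#s).choose j * c ^ j := by
  unfold esum edgeWeight
  rw [sum_congr rfl (g := fun _ => c ^ j), sum_const, card_powersetCard, nsmul_eq_mul]
  intro f hf
  rw [prod_const, (mem_powersetCard.1 hf).2]

end Symmetric

/-! ### The Lagrangian of the complete 3-graph -/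

section CompleteGraph

variable {α : Type*}

/-- The Lagrangian of the complete `3`-graph on `n` vertices. -/
noncomputable abbrev cliqueLagrangian (n : ℕ) : ℝ := (RGraph.complete 3 (Fin n)).lagrangian

theorem esum_univ_le_cliqueLagrangian {n : ℕ} {x : Fin n → ℝ} (hx : x ∈ stdSimplex ℝ (Fin n)) :
    esum 3 univ x ≤ cliqueLagrangian n := by
  have : Nonempty (Fin n) := by
    by_contra h
    rw [not_nonempty_iff] at h
    simpa using hx.2
  exact (RGraph.lagrangian_isGreatest (RGraph.complete 3 (Fin n))).2 ⟨x, hx, rfl⟩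

theorem choose_div_le_cliqueLagrangian {n : ℕ} (hn : 0 < n) :
    (n.choose 3 : ℝ) / n ^ 3 ≤ cliqueLagrangian n := by
  have hn' : (0 : ℝ) < n := by exact_mod_cast hn
  have hx : (fun _ => (1 : ℝ) / n) ∈ stdSimplex ℝ (Fin n) :=
    ⟨fun _ => by positivity, by simp [hn'.ne']⟩
  have := esum_univ_le_cliqueLagrangian hx
  rw [esum_const, card_univ, Fintype.card_fin] at this
  convert this using 1
  field_simp

theorem exists_pad_fin {n : ℕ} {s : Finset α} (hs : #s ≤ n) {y : α → ℝ} (hy : ∀ i, 0 ≤ y i)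
    (hsum : ∑ i ∈ s, y i = 1) :
    ∃ x ∈ stdSimplex ℝ (Fin n), esum 3 s y ≤ esum 3 univ x ∧ (#s < n → ∃ j, x j = 0) := by
  classical
  obtain ⟨g⟩ : Nonempty (s ↪ Fin n) :=
    Function.Embedding.nonempty_of_card_le (by simpa using hs)
  set x : Fin n → ℝ := Function.extend g (fun i => y i) 0 with hxdef
  have hg : ∀ i, x (g i) = y i := fun i => g.injective.extend_apply _ _ i
  have hout : ∀ j, j ∉ Set.range g → x j = 0 := fun j hj => by
    rw [hxdef, Function.extend_apply']
    · rfl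
    · exact hj
  have hx0 : ∀ j, 0 ≤ x j := fun j => by
    by_cases h : j ∈ Set.range g
    · obtain ⟨i, rfl⟩ := h
      rw [hg]
      exact hy i
    · rw [hout j h]
  refine ⟨x, ⟨hx0, ?_⟩, ?_, fun hlt => ?_⟩
  · rw [← hsum, ← sum_coe_sort s y, ← sum_subset (subset_univ (univ.map g)), sum_map]
    · exact sum_congr rfl fun i _ => hg i
    · intro j _ hj
      exact hout j (by simpa using hj)
  · calc esum 3 s y = esum 3 (univ.map g) x := by
          rw [esum_map]
          conv_lhs => rw [← attach_map_val (s := s), esum_map]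
          exact esum_congr fun i _ => (hg i).symm
      _ ≤ _ := esum_mono (subset_univ _) hx0
  · by_contra! h
    have hsurj : Function.Surjective g := fun j => by
      by_contra hj
      exact h j (hout j hj)
    have := Fintype.card_le_of_surjective g hsurj
    simp at this
    omega

theorem esum_le_cliqueLagrangian {n : ℕ} {s : Finset α} (hs : #s ≤ n) {y : α → ℝ}
    (hy : ∀ i, 0 ≤ y i) (hsum : ∑ i ∈ s, y i = 1) : esum 3 s y ≤ cliqueLagrangian n := by
  obtain ⟨x, hx, h, -⟩ := exists_pad_fin hs hy hsum
  exact h.trans (esum_univ_le_cliqueLagrangian hx)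

/-- Splitting the weight of a used vertex i equally between i and the unused j gains (x_i²/4) times
the weight of the other vertices. If that is zero, all weight sits on i and the sum vanishes. -/
theorem esum_univ_lt_cliqueLagrangian {n : ℕ} (hn : 3 ≤ n) {x : Fin n → ℝ}
    (hx : x ∈ stdSimplex ℝ (Fin n)) {j : Fin n} (hj : x j = 0) :
    esum 3 univ x < cliqueLagrangian n := by
  obtain ⟨i, hi⟩ : ∃ i, x i ≠ 0 := by
    by_contra! h
    simpa [h] using hx.2
  have hij : i ≠ j := fun h => hi (h ▸ hj)
  have hipos : 0 < x i := lt_of_le_of_ne (hx.1 i) hi.symm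
  set s : Finset (Fin n) := (univ.erase j).erase i with hs
  have his : i ∉ s := by simp [hs]
  have hjs : j ∉ insert i s := by simp [hs, hij.symm]
  have huniv : (univ : Finset (Fin n)) = insert j (insert i s) := by
    rw [hs, insert_erase (by simp [hij]), insert_erase (mem_univ j)]
  have hsum : x i + ∑ l ∈ s, x l = 1 := by
    have := hx.2
    rwa [huniv, sum_insert hjs, sum_insert his, hj, zero_add] at this
  have hexp : esum 3 univ x = esum 3 s x + x i * esum 2 s x := by
    rw [huniv, esum_insert 2 hjs, esum_insert 2 his, hj, zero_mul, add_zero]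
  have hpos : 0 < cliqueLagrangian n :=
    lt_of_lt_of_le (by have := Nat.choose_pos hn; positivity)
      (choose_div_le_cliqueLagrangian (by omega))
  rcases (sum_nonneg fun l (_ : l ∈ s) => hx.1 l).eq_or_lt with h0 | h0
  · have hz : ∀ l ∈ s, x l = 0 :=
      (sum_eq_zero_iff_of_nonneg fun l _ => hx.1 l).1 h0.symm
    have h2 := two_mul_esum_two s x
    rw [← h0, sum_eq_zero fun l hl => by rw [hz l hl]; norm_num] at h2
    have h3 : esum 3 s x = 0 := by
      refine sum_eq_zero (s := powersetCard 3 s) fun f hf => ?_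
      obtain ⟨hfs, hf3⟩ := mem_powersetCard.1 hf
      obtain ⟨l, hl⟩ := card_pos.1 (by omega : 0 < #f)
      exact prod_eq_zero hl (hz l (hfs hl))
    rw [hexp, h3, show esum 2 s x = 0 by linarith]
    simpa using hpos
  · set y : Fin n → ℝ := fun l => if l = i ∨ l = j then x i / 2 else x l with hy
    have hyi : y i = x i / 2 := by simp [hy]
    have hyj : y j = x i / 2 := by simp [hy]
    have hys : ∀ l ∈ s, y l = x l := fun l hl => by
      have : ¬(l = i ∨ l = j) := by
        simp only [hs, mem_erase] at hl
        tauto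
      simp [hy, this]
    have hy1 : y ∈ stdSimplex ℝ (Fin n) := by
      refine ⟨fun l => ?_, ?_⟩
      · simp only [hy]
        split_ifs
        · linarith
        · exact hx.1 l
      · rw [huniv, sum_insert hjs, sum_insert his, hyi, hyj, sum_congr rfl hys]
        linarith
    have h := esum_univ_le_cliqueLagrangian hy1
    rw [huniv, esum_insert 2 hjs, esum_insert 2 his, esum_insert 1 his, esum_one, hyi, hyj,
      sum_congr rfl hys, esum_congr hys, esum_congr hys] at h
    rw [hexp]
    nlinarith [mul_pos (mul_pos hipos hipos) h0]

theorem esum_lt_cliqueLagrangian {n : ℕ} (hn : 3 ≤ n) {s : Finset α} (hs : #s < n) {y : α → ℝ}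
    (hy : ∀ i, 0 ≤ y i) (hsum : ∑ i ∈ s, y i = 1) : esum 3 s y < cliqueLagrangian n := by
  obtain ⟨x, hx, h, hj⟩ := exists_pad_fin hs.le hy hsum
  obtain ⟨j, hj⟩ := hj hs
  exact h.trans_lt (esum_univ_lt_cliqueLagrangian hn hx hj)

end CompleteGraph

/-! ### Weight shifts and first-order conditions -/

section FirstOrder

variable {α : Type*} [DecidableEq α]

/-- The derivative of `edgeWeight E` in the direction of the vertex `a`. -/
def linkWeight (E : Finset (Finset α)) (a : α) (x : α → ℝ) : ℝ :=
  ∑ e ∈ E with a ∈ e, ∏ i ∈ e.erase a, x i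

/-- The second derivative of `edgeWeight E` in the directions of the vertices `a` and `c`. -/
def pairWeight (E : Finset (Finset α)) (a c : α) (x : α → ℝ) : ℝ :=
  ∑ e ∈ E with a ∈ e ∧ c ∈ e, ∏ i ∈ (e.erase a).erase c, x i

/-- The weighting obtained from `x` by moving the weight `s` from `c` to `a`. -/
def shiftWeight (x : α → ℝ) (a c : α) (s : ℝ) : α → ℝ :=
  fun i => if i = a then x a + s else if i = c then x c - s else x i

theorem shiftWeight_left (x : α → ℝ) (a c : α) (s : ℝ) : shiftWeight x a c s a = x a + s := by
  simp [shiftWeight]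

theorem shiftWeight_right (x : α → ℝ) {a c : α} (h : a ≠ c) (s : ℝ) :
    shiftWeight x a c s c = x c - s := by
  simp [shiftWeight, h.symm]

theorem shiftWeight_of_ne (x : α → ℝ) {a c i : α} (ha : i ≠ a) (hc : i ≠ c) (s : ℝ) :
    shiftWeight x a c s i = x i := by
  simp [shiftWeight, ha, hc]

/-- The product is affine in each weight, so this second-order expansion is exact. -/
theorem prod_shiftWeight (x : α → ℝ) {a c : α} (h : a ≠ c) (s : ℝ) (e : Finset α) :
    ∏ i ∈ e, shiftWeight x a c s i = ∏ i ∈ e, x i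
      + s * ((if a ∈ e then ∏ i ∈ e.erase a, x i else 0)
        - if c ∈ e then ∏ i ∈ e.erase c, x i else 0)
      - s ^ 2 * if a ∈ e ∧ c ∈ e then ∏ i ∈ (e.erase a).erase c, x i else 0 := by
  have key : ∀ f : Finset α, a ∉ f → c ∉ f →
      ∏ i ∈ f, shiftWeight x a c s i = ∏ i ∈ f, x i := fun f hfa hfc =>
    prod_congr rfl fun i hi => shiftWeight_of_ne x (ne_of_mem_of_not_mem hi hfa)
      (ne_of_mem_of_not_mem hi hfc) s
  by_cases ha : a ∈ e <;> by_cases hc : c ∈ e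
  · have hc' : c ∈ e.erase a := mem_erase.2 ⟨h.symm, hc⟩
    have ha' : a ∈ e.erase c := mem_erase.2 ⟨h, ha⟩
    rw [← mul_prod_erase e _ ha, ← mul_prod_erase (e.erase a) _ hc', key _ (by simp) (by simp),
      ← mul_prod_erase e x ha, ← mul_prod_erase (e.erase a) x hc',
      ← mul_prod_erase (e.erase c) x ha', erase_right_comm, shiftWeight_left,
      shiftWeight_right x h]
    simp only [ha, hc, if_true, and_self]
    ring
  · rw [← mul_prod_erase e _ ha, key _ (by simp) (by simp [hc]), ← mul_prod_erase e x ha,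
      shiftWeight_left]
    simp only [ha, hc, if_true, if_false, and_false]
    ring
  · rw [← mul_prod_erase e _ hc, key _ (by simp [ha]) (by simp), ← mul_prod_erase e x hc,
      shiftWeight_right x h]
    simp only [ha, hc, if_true, if_false, false_and]
    ring
  · simp [ha, hc, key]

theorem edgeWeight_shiftWeight (E : Finset (Finset α)) (x : α → ℝ) {a c : α} (h : a ≠ c)
    (s : ℝ) :
    edgeWeight E (shiftWeight x a c s) = edgeWeight E x
      + s * (linkWeight E a x - linkWeight E c x) - s ^ 2 * pairWeight E a c x := by
  unfold edgeWeight linkWeight pairWeight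
  simp_rw [sum_filter, prod_shiftWeight x h s]
  rw [sum_sub_distrib, sum_add_distrib, ← mul_sum, ← mul_sum, sum_sub_distrib]

theorem sum_mul_linkWeight [Fintype α] {E : Finset (Finset α)} {r : ℕ} (hE : ∀ e ∈ E, #e = r)
    (x : α → ℝ) : ∑ a, x a * linkWeight E a x = r * edgeWeight E x := by
  unfold edgeWeight linkWeight
  simp_rw [sum_filter, mul_sum, mul_ite, mul_zero]
  rw [sum_comm]
  refine sum_congr rfl fun e he => ?_
  rw [← sum_filter, filter_mem_eq_inter, univ_inter,
    sum_congr rfl fun a ha => mul_prod_erase e x ha, sum_const, hE e he, nsmul_eq_mul]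

theorem shiftWeight_mem_stdSimplex [Fintype α] {x : α → ℝ} (hx : x ∈ stdSimplex ℝ α) {a c : α}
    (h : a ≠ c) {s : ℝ} (hsa : 0 ≤ x a + s) (hsc : s ≤ x c) :
    shiftWeight x a c s ∈ stdSimplex ℝ α := by
  refine ⟨fun i => ?_, ?_⟩
  · unfold shiftWeight
    split_ifs
    · exact hsa
    · linarith
    · exact hx.1 i
  · have hc : c ∈ univ.erase a := mem_erase.2 ⟨h.symm, mem_univ c⟩
    rw [← hx.2, ← add_sum_erase univ _ (mem_univ a), ← add_sum_erase _ _ hc,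
      ← add_sum_erase univ x (mem_univ a), ← add_sum_erase _ x hc, shiftWeight_left,
      shiftWeight_right x h, sum_congr rfl fun i hi => shiftWeight_of_ne x
        (by simp only [mem_erase] at hi; tauto) (by simp only [mem_erase] at hi; tauto) s]
    ring

theorem linkWeight_le_of_isMax [Fintype α] {E : Finset (Finset α)} {x : α → ℝ}
    (hx : x ∈ stdSimplex ℝ α) (hmax : ∀ y ∈ stdSimplex ℝ α, edgeWeight E y ≤ edgeWeight E x)
    {a c : α} (hc : 0 < x c) : linkWeight E a x ≤ linkWeight E c x := by
  rcases eq_or_ne a c with rfl | h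
  · rfl
  by_contra! hlt
  set d := linkWeight E a x - linkWeight E c x with hd
  have hd0 : 0 < d := by linarith
  have hN : 0 ≤ pairWeight E a c x := sum_nonneg fun _ _ => prod_nonneg fun i _ => hx.1 i
  -- Small enough that the gain s * d exceeds the quadratic loss s² * `pairWeight`; the + 1 avoids
  -- division by zero.
  set s := min (x c) (d / (2 * (pairWeight E a c x + 1))) with hs
  have hs0 : 0 < s := lt_min hc (by positivity)
  have hs1 : s * (2 * (pairWeight E a c x + 1)) ≤ d := by
    rw [← le_div_iff₀ (by positivity)]
    exact min_le_right _ _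
  have := hmax _ (shiftWeight_mem_stdSimplex hx h (by linarith [hx.1 a]) (min_le_left _ _ : s ≤ x c))
  rw [edgeWeight_shiftWeight E x h] at this
  nlinarith

theorem linkWeight_eq_of_isMax [Fintype α] {E : Finset (Finset α)} {r : ℕ}
    (hE : ∀ e ∈ E, #e = r) {x : α → ℝ} (hx : x ∈ stdSimplex ℝ α) (hpos : ∀ i, 0 < x i)
    (hmax : ∀ y ∈ stdSimplex ℝ α, edgeWeight E y ≤ edgeWeight E x) (a : α) :
    linkWeight E a x = r * edgeWeight E x := by
  rw [← sum_mul_linkWeight hE x, sum_congr rfl fun i _ => by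
    rw [(linkWeight_le_of_isMax hx hmax (hpos a)).antisymm
      (linkWeight_le_of_isMax hx hmax (hpos i))], ← sum_mul, hx.2, one_mul]

theorem two_mul_linkWeight_le [Fintype α] {E : Finset (Finset α)} (hE : ∀ e ∈ E, #e = 3)
    {x : α → ℝ} (hx : x ∈ stdSimplex ℝ α) (a : α) :
    2 * linkWeight E a x ≤ 1 - 2 * x a + 2 * x a ^ 2 - ∑ i, x i ^ 2 := by
  have h1 : linkWeight E a x ≤ esum 2 (univ.erase a) x := by
    unfold linkWeight
    rw [← sum_image (s := E.filter (a ∈ ·)) (g := fun e => e.erase a)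
      (f := fun f => ∏ i ∈ f, x i)]
    · refine edgeWeight_mono ?_ hx.1
      intro f hf
      obtain ⟨e, he, rfl⟩ := mem_image.1 hf
      obtain ⟨heE, hae⟩ := mem_filter.1 he
      exact mem_powersetCard.2 ⟨erase_subset_erase a (subset_univ e),
        by rw [card_erase_of_mem hae, hE e heE]⟩
    · intro e he f hf h
      rw [← insert_erase (mem_filter.1 he).2, ← insert_erase (mem_filter.1 hf).2]
      exact congrArg (insert a) h
  have h2 := two_mul_esum_two (univ.erase a) x
  have h3 := hx.2
  rw [← add_sum_erase univ x (mem_univ a)] at h3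
  rw [← add_sum_erase univ (fun i => x i ^ 2) (mem_univ a)]
  rw [show ∑ i ∈ univ.erase a, x i = 1 - x a by linarith] at h2
  nlinarith

end FirstOrder

/-! ### Numerical inequalities behind the two contradictions -/

theorem le_half_of_cap {n u Q : ℝ} (hn : 5 ≤ n) (hu : u ≤ 1) (huQ : u ^ 2 ≤ Q)
    (hcap : 2 * u - 2 * u ^ 2 + Q ≤ (3 * n - 2) / n ^ 2) : u ≤ 1 / 2 := by
  have hκ : (3 * n - 2) / n ^ 2 ≤ 13 / 25 := by
    rw [div_le_div_iff₀ (by positivity) (by norm_num)]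
    nlinarith
  by_contra! h
  nlinarith

theorem large_support_contradiction {n u Q s : ℝ} (hn : 5 ≤ n) (hu : u ≤ 1)
    (hu1 : 1 ≤ (n - 1) * u) (hs : 1 - u ≤ s) (hsQ : s ^ 2 ≤ (n - 2) * Q) (huQ : u ^ 2 ≤ Q)
    (hcap : 2 * u - 2 * u ^ 2 + Q ≤ (3 * n - 2) / n ^ 2) : False := by
  have hn0 : 0 < n := by linarith
  have hu2 := le_half_of_cap hn hu huQ hcap
  rw [le_div_iff₀ (by positivity)] at hcap
  have hs2 : (1 - u) ^ 2 ≤ (n - 2) * Q := le_trans (by nlinarith) hsQ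
  -- Eliminating Q leaves a concave quadratic in u, to be bounded below on [1/(n-1), 1/2]; `h4`
  -- shows that its minimum is at the left end.
  have h1 : (1 + (2 * n - 6) * u - (2 * n - 5) * u ^ 2) * n ^ 2 ≤ (3 * n - 2) * (n - 2) := by
    have e1 := mul_le_mul_of_nonneg_right hcap (by linarith : 0 ≤ n - 2)
    have e2 := mul_le_mul_of_nonneg_right hs2 (by positivity : 0 ≤ n ^ 2)
    linarith
  have h2 : 0 ≤ (n - 1) * (2 * n - 5) * (((n - 1) * u - 1) * (1 - 2 * u)) :=
    mul_nonneg (mul_nonneg (by linarith) (by linarith)) (mul_nonneg (by linarith) (by linarith))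
  have h3 : 0 ≤ (2 * n ^ 2 - 13 * n + 17) * ((n - 1) * u - 1) :=
    mul_nonneg (by nlinarith) (by linarith)
  have h4 : 3 * (n - 2) ^ 2 ≤ (n - 1) ^ 2 * (1 + (2 * n - 6) * u - (2 * n - 5) * u ^ 2) := by
    linarith
  have h5 := mul_le_mul_of_nonneg_right h4 (by positivity : 0 ≤ n ^ 2)
  have h6 := mul_le_mul_of_nonneg_left h1 (by positivity : 0 ≤ (n - 1) ^ 2)
  have h7 : 0 < (n - 2) * (2 * n ^ 2 - 7 * n + 2) := mul_pos (by linarith) (by nlinarith)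
  linarith

theorem critical_support_contradiction {n u d Q : ℝ} (hn : 5 ≤ n) (hu0 : 0 < u) (hu : u ≤ 1)
    (hd : n * u ≤ (3 * n - 8) * d) (hsum : 4 * d ≤ (n + 1) * u - 1)
    (hQ : 2 * u - (n + 1) * u ^ 2 + 4 * d ^ 2 ≤ Q) (hQ1 : 1 ≤ (n + 1) * Q) (huQ : u ^ 2 ≤ Q)
    (hcap : 2 * u - 2 * u ^ 2 + Q ≤ (3 * n - 2) / n ^ 2) : False := by
  have hn0 : 0 < n := by linarith
  have hu2 := le_half_of_cap hn hu huQ hcap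
  rw [le_div_iff₀ (by positivity)] at hcap
  have hu3 : 2 * n * u ≤ 3 := by
    by_contra! h
    have e1 : 0 ≤ (2 * n * u - 3) * (1 - 2 * u) := mul_nonneg (by linarith) (by linarith)
    have e2 : 0 ≤ (n - 3) * (2 * n * u - 3) := mul_nonneg (by linarith) (by linarith)
    have e3 : 3 * (2 * n - 3) ≤ 2 * n ^ 2 * (2 * u - 2 * u ^ 2) := by
      nlinarith [mul_nonneg hn0.le e1]
    have e4 := mul_le_mul_of_nonneg_right hcap (by linarith : 0 ≤ n + 1)
    have e5 := mul_le_mul_of_nonneg_right hQ1 (by positivity : 0 ≤ n ^ 2)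
    have e6 := mul_le_mul_of_nonneg_right e3 (by linarith : 0 ≤ n + 1)
    nlinarith
  set c := 3 * n - 8 with hc
  set A := 3 * n ^ 2 - 9 * n - 8 with hA
  set B := (n + 3) * c ^ 2 - 4 * n ^ 2 with hB
  have hc0 : 0 < c := by linarith
  have hA0 : 0 < A := by nlinarith
  have hB0 : 0 ≤ B := by
    rw [hB, hc]
    nlinarith [mul_nonneg (by linarith : 0 ≤ n - 5) (by positivity : 0 ≤ n ^ 2)]
  have hAu : c ≤ A * u := by
    have := mul_le_mul_of_nonneg_right hsum hc0.le
    rw [hA]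
    rw [hc] at *
    linarith
  have hd2 : n ^ 2 * u ^ 2 ≤ c ^ 2 * d ^ 2 := by
    -- Squaring `hd` lets d be eliminated: `hφ` below is a concave quadratic condition on u alone,
    -- for u in [c/A, 3/(2n)].
    have : (n * u) ^ 2 ≤ (c * d) ^ 2 := pow_le_pow_left₀ (by positivity) hd 2
    linarith
  have hφ : (4 * c ^ 2 * u - B * u ^ 2) * n ^ 2 ≤ c ^ 2 * (3 * n - 2) := by
    have e1 : (4 * u - (n + 3) * u ^ 2 + 4 * d ^ 2) * n ^ 2 ≤ 3 * n - 2 :=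
      le_trans (mul_le_mul_of_nonneg_right (by linarith) (by positivity)) hcap
    have e2 := mul_le_mul_of_nonneg_left e1 (by positivity : 0 ≤ c ^ 2)
    have e3 := mul_le_mul_of_nonneg_right hd2 (by positivity : 0 ≤ 4 * n ^ 2)
    rw [hB]
    linarith
  -- The chord of that quadratic over [c/A, 3/(2n)] has nonnegative slope, so its minimum is at c/A.
  -- After n = m + 5 all coefficients are nonnegative.
  have hK : 0 ≤ 8 * n * A * c ^ 2 - B * (3 * A + 2 * n * c) := by
    obtain ⟨m, hm, rfl⟩ : ∃ m : ℝ, 0 ≤ m ∧ n = m + 5 := ⟨n - 5, by linarith, by ring⟩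
    rw [hB, hA, hc]
    ring_nf
    positivity
  have h1 : 0 ≤ B * ((A * u - c) * (3 - 2 * n * u)) :=
    mul_nonneg hB0 (mul_nonneg (by linarith) (by linarith))
  have h2 := mul_nonneg hK (by linarith : 0 ≤ A * u - c)
  have h3 : 2 * n * c ^ 2 * (4 * A * c - B) ≤ 2 * n * (A ^ 2 * (4 * c ^ 2 * u - B * u ^ 2)) := by
    linarith [mul_nonneg hA0.le h1]
  have h4 : c ^ 2 * (4 * A * c - B) ≤ A ^ 2 * (4 * c ^ 2 * u - B * u ^ 2) := by
    refine le_of_mul_le_mul_left ?_ (by positivity : 0 < 2 * n)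
    linarith
  have h5 := mul_le_mul_of_nonneg_right h4 (by positivity : 0 ≤ n ^ 2)
  have h6 := mul_le_mul_of_nonneg_left hφ (by positivity : 0 ≤ A ^ 2)
  have h7 : (4 * A * c - B) * n ^ 2 ≤ A ^ 2 * (3 * n - 2) := by
    refine le_of_mul_le_mul_left ?_ (by positivity : 0 < c ^ 2)
    linarith
  have h8 : 0 < (4 * A * c - B) * n ^ 2 - A ^ 2 * (3 * n - 2) := by
    obtain ⟨m, hm, rfl⟩ : ∃ m : ℝ, 0 ≤ m ∧ n = m + 5 := ⟨n - 5, by linarith, by ring⟩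
    rw [hB, hA, hc]
    ring_nf
    positivity
  linarith

theorem six_mul_choose_three (m : ℕ) : 6 * (m + 2).choose 3 = m * (m + 1) * (m + 2) := by
  induction m with
  | zero => rfl
  | succ m ih =>
    have h := Nat.choose_two_right (m + 2)
    have h2 : 2 * (m + 2).choose 2 = (m + 2) * (m + 1) := by
      rw [h, Nat.mul_div_cancel']
      · rfl
      · exact (Nat.even_mul_pred_self _).two_dvd
    rw [show m + 1 + 2 = (m + 2) + 1 by ring, Nat.choose_succ_succ' (m + 2) 2]
    linarith

/-! ### Extremal pairs and compression of the two lightest vertices -/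

section Extremal

variable {k : ℕ}

theorem exists_lt_lt_of_card_eq_three {e : Finset (Fin k)} (he : #e = 3) :
    ∃ p q r, p < q ∧ q < r ∧ e = {p, q, r} := by
  refine ⟨e.orderEmbOfFin he 0, e.orderEmbOfFin he 1, e.orderEmbOfFin he 2, by simp, by simp, ?_⟩
  ext i
  have h : i ∈ e ↔ ∃ j, e.orderEmbOfFin he j = i := by
    rw [← mem_coe, ← range_orderEmbOfFin e he, Set.mem_range]
  rw [h]
  simp [Fin.exists_fin_succ, eq_comm]

theorem exists_eq_insert_pair {α : Type*} [DecidableEq α] {e : Finset α} (he : #e = 3) {a c : α}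
    (h : a ≠ c) (ha : a ∈ e) (hc : c ∈ e) : ∃ i, i ≠ a ∧ i ≠ c ∧ e = {i, a, c} := by
  have hc' : c ∈ e.erase a := mem_erase.2 ⟨h.symm, hc⟩
  obtain ⟨i, hi⟩ : ∃ i, (e.erase a).erase c = {i} := by
    rw [← card_eq_one, card_erase_of_mem hc', card_erase_of_mem ha, he]
  have hi' : i ∈ (e.erase a).erase c := by simp [hi]
  simp only [mem_erase] at hi'
  refine ⟨i, hi'.2.1, hi'.1, ?_⟩
  rw [← insert_erase ha, ← insert_erase hc', hi]
  ext j
  simp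
  tauto

/-- A `3`-uniform family with at most `C(n+1, 3) - (3n - 2)/2` edges. -/
structure Sparse (n : ℕ) {α : Type*} (E : Finset (Finset α)) : Prop where
  card_of_mem : ∀ e ∈ E, #e = 3
  card_le : 2 * #E + 3 * n ≤ 2 * (n + 1).choose 3 + 2

/-- The pair `(E, x)` has maximal weight, which is at least the Lagrangian of the complete graph on
`n` vertices, among all sparse families and weightings on `Fin k`; the weights `x` are positive and
decreasing. -/
structure Extremal (n : ℕ) (E : Finset (Finset (Fin k))) (x : Fin k → ℝ) : Prop where
  sparse : Sparse n E
  mem : x ∈ stdSimplex ℝ (Fin k)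
  pos : ∀ i, 0 < x i
  anti : Antitone x
  le : cliqueLagrangian n ≤ edgeWeight E x
  max : ∀ E', Sparse n E' → ∀ y ∈ stdSimplex ℝ (Fin k), edgeWeight E' y ≤ edgeWeight E x

/-- The vertices that form an edge together with `a` and `c`. -/
def pairNbrs (E : Finset (Finset (Fin k))) (a c : Fin k) : Finset (Fin k) :=
  {i | i ≠ a ∧ i ≠ c ∧ {i, a, c} ∈ E}

/-- Every triple containing a neighbour of the pair `a, c` is an edge. -/
def PairClosed (E : Finset (Finset (Fin k))) (a c : Fin k) : Prop :=
  ∀ i ∈ pairNbrs E a c, ∀ e : Finset (Fin k), #e = 3 → i ∈ e → e ∈ E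

variable {n : ℕ} {E : Finset (Finset (Fin k))} {x : Fin k → ℝ} {a c : Fin k}

theorem prod_last_two_le (hx : Antitone x) (hx0 : ∀ i, 0 ≤ x i) (ha : (a : ℕ) + 2 = k)
    (hc : (c : ℕ) + 1 = k) {p q : Fin k} (h : p ≠ q) : x a * x c ≤ x p * x q := by
  have key : ∀ p q : Fin k, p < q → x a * x c ≤ x p * x q := fun p q hpq =>
    mul_le_mul (hx (by rw [Fin.le_def]; rw [Fin.lt_def] at hpq; omega))
      (hx (by rw [Fin.le_def]; omega)) (hx0 c) (hx0 p)
  rcases h.lt_or_gt with h | h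
  · exact key p q h
  · rw [mul_comm (x p)]
    exact key q p h

theorem prod_triple {α : Type*} [DecidableEq α] (x : α → ℝ) {i j l : α} (h : i ≠ j)
    (h' : i ≠ l) (h'' : j ≠ l) : ∏ v ∈ {i, j, l}, x v = x i * (x j * x l) := by
  rw [prod_insert (by simp [h, h']), prod_pair h'']

/-- Take an extremal family with fewest neighbours of the pair. If {i, a, c} is an edge and a triple
e through i is not, exchanging them keeps the size and does not lower the weight, since x_a x_c is
the least product of two weights; this contradicts minimality. -/
theorem Extremal.exists_pairClosed (h : Extremal n E x) (ha : (a : ℕ) + 2 = k)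
    (hc : (c : ℕ) + 1 = k) : ∃ E', Extremal n E' x ∧ PairClosed E' a c := by
  have hac : a ≠ c := fun hh => by rw [hh] at ha; omega
  obtain ⟨F, hF, hmin⟩ := Set.exists_min_image {E' | Extremal n E' x}
    (fun E' => #(pairNbrs E' a c)) (Set.toFinite _) ⟨E, h⟩
  refine ⟨F, hF, fun i hi e he hie => ?_⟩
  have hF : Extremal n F x := hF
  by_contra heF
  obtain ⟨hia, hic, hiF⟩ : i ≠ a ∧ i ≠ c ∧ {i, a, c} ∈ F := by simpa [pairNbrs] using hi
  set f : Finset (Fin k) := {i, a, c} with hf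
  have heF' : e ∉ F.erase f := fun hh => heF (mem_of_mem_erase hh)
  have hprod : ∏ v ∈ f, x v ≤ ∏ v ∈ e, x v := by
    obtain ⟨p, q, hpq, hpq'⟩ := card_eq_two.1
      (show #(e.erase i) = 2 by rw [card_erase_of_mem hie, he])
    rw [prod_triple x hia hic hac, ← mul_prod_erase e x hie, hpq', prod_pair hpq]
    exact mul_le_mul_of_nonneg_left (prod_last_two_le hF.anti hF.mem.1 ha hc hpq) (hF.pos i).le
  have hw : edgeWeight F x ≤ edgeWeight (insert e (F.erase f)) x := by
    unfold edgeWeight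
    rw [sum_insert heF', ← add_sum_erase F _ hiF]
    linarith
  have hcard : #(insert e (F.erase f)) = #F := by
    rw [card_insert_of_notMem heF', card_erase_add_one hiF]
  have hnew : Extremal n (insert e (F.erase f)) x :=
    { sparse := ⟨fun g hg => by
          rcases mem_insert.1 hg with rfl | hg
          · exact he
          · exact hF.sparse.card_of_mem g (mem_of_mem_erase hg),
        by rw [hcard]; exact hF.sparse.card_le⟩
      mem := hF.mem
      pos := hF.pos
      anti := hF.anti
      le := hF.le.trans hw
      max := fun E' hE' y hy => (hF.max E' hE' y hy).trans hw }
  refine absurd (hmin _ hnew) (not_le.2 (card_lt_card ?_))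
  refine ⟨fun j hj => ?_, fun hsub => ?_⟩
  · simp only [pairNbrs, mem_filter, mem_univ, true_and, mem_insert, mem_erase] at hj ⊢
    refine ⟨hj.1, hj.2.1, ?_⟩
    rcases hj.2.2 with h' | h'
    · have hij : i ∈ ({j, a, c} : Finset (Fin k)) := h' ▸ hie
      simp only [mem_insert, mem_singleton, hia, hic, or_false] at hij
      rw [← hij]
      exact hiF
    · exact h'.2
  · have := hsub hi
    simp only [pairNbrs, mem_filter, mem_univ, true_and, mem_insert, mem_erase] at this
    rcases this.2.2 with h' | h'
    · exact heF (h' ▸ hiF)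
    · exact h'.1 rfl

/-- With n - 3 neighbours inside an (n+1)-set, only triples among its other 4 vertices can be
missing there: at most 4, fewer than sparsity demands. -/
theorem Extremal.card_pairNbrs_add_four_le (h : Extremal n E x) (hn : 4 ≤ n) (hk : n + 1 ≤ k)
    (hcl : PairClosed E a c) : #(pairNbrs E a c) + 4 ≤ n := by
  by_contra! hlt
  obtain ⟨N, hN, hNc⟩ := exists_subset_card_eq (show n - 3 ≤ #(pairNbrs E a c) by omega)
  obtain ⟨P, hNP, hPc⟩ := exists_superset_card_eq (show #N ≤ n + 1 by omega)
    (show n + 1 ≤ Fintype.card (Fin k) by simpa using hk)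
  have hsub : powersetCard 3 P ⊆ E ∪ powersetCard 3 (P \ N) := fun e he => by
    obtain ⟨heP, he3⟩ := mem_powersetCard.1 he
    rw [mem_union]
    by_cases hd : Disjoint e N
    · right
      exact mem_powersetCard.2 ⟨subset_sdiff.2 ⟨heP, hd⟩, he3⟩
    · left
      obtain ⟨i, hie, hiN⟩ := not_disjoint_iff.1 hd
      exact hcl i (hN hiN) e he3 hie
  have h1 := (card_le_card hsub).trans (card_union_le _ _)
  rw [card_powersetCard, card_powersetCard, card_sdiff_of_subset hNP, hPc, hNc,
    show n + 1 - (n - 3) = 4 by omega, show Nat.choose 4 3 = 4 from rfl] at h1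
  have := h.sparse.card_le
  omega

theorem Extremal.linkWeight_eq (h : Extremal n E x) (i : Fin k) :
    linkWeight E i x = 3 * edgeWeight E x :=
  linkWeight_eq_of_isMax h.sparse.card_of_mem h.mem h.pos (h.max E h.sparse) i

/-- The link weight of i equals 3 λ ≥ 3 C(n,3)/n³, yet is at most the degree-two symmetric sum of
the other weights. -/
theorem Extremal.cap (h : Extremal n E x) (hn : 4 ≤ n) (i : Fin k) :
    2 * x i - 2 * x i ^ 2 + ∑ j, x j ^ 2 ≤ (3 * n - 2) / n ^ 2 := by
  have h1 := two_mul_linkWeight_le h.sparse.card_of_mem h.mem i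
  rw [h.linkWeight_eq] at h1
  have h2 := (choose_div_le_cliqueLagrangian (show 0 < n by omega)).trans h.le
  obtain ⟨m, rfl⟩ : ∃ m, n = m + 2 := ⟨n - 2, by omega⟩
  have h3 : (6 : ℝ) * (m + 2).choose 3 = m * (m + 1) * (m + 2) := by
    exact_mod_cast six_mul_choose_three m
  have h4 : 6 * (((m + 2).choose 3 : ℝ) / ((m + 2 : ℕ) : ℝ) ^ 3)
      = 1 - (3 * ((m + 2 : ℕ) : ℝ) - 2) / ((m + 2 : ℕ) : ℝ) ^ 2 := by
    rw [← mul_div_assoc, h3]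
    push_cast
    field_simp
    ring
  linarith

end Extremal

/-! ### Support of at least n + 2 vertices -/

section LargeSupport

variable {k n : ℕ} {E : Finset (Finset (Fin k))} {x : Fin k → ℝ} {a c : Fin k}

theorem mem_pairNbrs {i : Fin k} :
    i ∈ pairNbrs E a c ↔ i ≠ a ∧ i ≠ c ∧ {i, a, c} ∈ E := by
  simp [pairNbrs]

theorem card_filter_pair_le (hE : ∀ e ∈ E, #e = 3) (h : a ≠ c) :
    #{e ∈ E | a ∈ e ∧ c ∈ e} ≤ #(pairNbrs E a c) := by
  refine (card_le_card (t := (pairNbrs E a c).image fun i => {i, a, c}) fun e he => ?_).trans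
    card_image_le
  obtain ⟨heE, hae, hce⟩ := mem_filter.1 he
  obtain ⟨i, hia, hic, rfl⟩ := exists_eq_insert_pair (hE e heE) h hae hce
  exact mem_image.2 ⟨i, mem_pairNbrs.2 ⟨hia, hic, heE⟩, rfl⟩

theorem pairWeight_le (hE : ∀ e ∈ E, #e = 3) (h : a ≠ c) {u : ℝ} (hu0 : 0 ≤ u)
    (hu : ∀ i, x i ≤ u) : pairWeight E a c x ≤ #(pairNbrs E a c) * u := by
  calc pairWeight E a c x ≤ ∑ e ∈ E with a ∈ e ∧ c ∈ e, u := by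
        refine sum_le_sum fun e he => ?_
        obtain ⟨heE, hae, hce⟩ := mem_filter.1 he
        have hc' : c ∈ e.erase a := mem_erase.2 ⟨h.symm, hce⟩
        obtain ⟨i, hi⟩ : ∃ i, (e.erase a).erase c = {i} := by
          rw [← card_eq_one, card_erase_of_mem hc', card_erase_of_mem hae, hE e heE]
        rw [hi, prod_singleton]
        exact hu i
    _ = #{e ∈ E | a ∈ e ∧ c ∈ e} * u := by rw [sum_const, nsmul_eq_mul]
    _ ≤ _ := by
        refine mul_le_mul_of_nonneg_right ?_ hu0
        exact_mod_cast card_filter_pair_le hE h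

/-- By closedness every pair avoiding c and meeting the b neighbours extends by c to an edge, so c
has degree at least C(k-1,2) - C(k-1-b,2). -/
theorem le_two_mul_degree (hcl : PairClosed E a c) (hk : 2 ≤ k)
    (hb : #(pairNbrs E a c) + 2 ≤ k) :
    (#(pairNbrs E a c) : ℝ) * (2 * k - 3 - #(pairNbrs E a c)) ≤ 2 * #{e ∈ E | c ∈ e} := by
  set N := pairNbrs E a c with hN
  have hNc : N ⊆ univ.erase c := fun i hi => mem_erase.2 ⟨(mem_pairNbrs.1 hi).2.1, mem_univ i⟩
  have hsub : powersetCard 2 (univ.erase c) ⊆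
      {e ∈ E | c ∈ e}.image (fun e => e.erase c) ∪ powersetCard 2 (univ.erase c \ N) := by
    intro f hf
    obtain ⟨hfc, hf2⟩ := mem_powersetCard.1 hf
    have hcf : c ∉ f := fun hh => by simpa using hfc hh
    rw [mem_union]
    by_cases hd : Disjoint f N
    · right
      exact mem_powersetCard.2 ⟨subset_sdiff.2 ⟨hfc, hd⟩, hf2⟩
    · left
      obtain ⟨i, hif, hiN⟩ := not_disjoint_iff.1 hd
      refine mem_image.2 ⟨insert c f, mem_filter.2 ⟨hcl i hiN _ ?_ ?_, mem_insert_self c f⟩,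
        erase_insert hcf⟩
      · rw [card_insert_of_notMem hcf, hf2]
      · exact mem_insert_of_mem hif
  have h1 := (card_le_card hsub).trans
    ((card_union_le _ _).trans (Nat.add_le_add_right card_image_le _))
  rw [card_powersetCard, card_powersetCard, card_sdiff_of_subset hNc,
    card_erase_of_mem (mem_univ c), card_univ, Fintype.card_fin] at h1
  have h2 : ((k - 1).choose 2 : ℝ) ≤ #{e ∈ E | c ∈ e} + ((k - 1 - #N).choose 2 : ℝ) := by
    exact_mod_cast h1
  rw [Nat.cast_choose_two, Nat.cast_choose_two, Nat.cast_sub (by omega : #N ≤ k - 1),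
    Nat.cast_sub (by omega : 1 ≤ k)] at h2
  push_cast at h2
  linarith

theorem prod_triple_ge (hx : Antitone x) (hx0 : ∀ i, 0 ≤ x i) {p q r : Fin k}
    (hpq : (p : ℕ) + 1 = q) (hqr : (q : ℕ) + 1 = r) {f : Finset (Fin k)} (hf : #f = 3)
    (hfr : ∀ i ∈ f, i ≤ r) : x p * (x q * x r) ≤ ∏ i ∈ f, x i := by
  obtain ⟨i, j, l, hij, hjl, rfl⟩ := exists_lt_lt_of_card_eq_three hf
  have hl : l ≤ r := hfr l (by simp)
  rw [prod_triple x hij.ne (hij.trans hjl).ne hjl.ne]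
  rw [Fin.lt_def] at hij hjl
  rw [Fin.le_def] at hl
  have h1 : x p ≤ x i := hx (by rw [Fin.le_def]; omega)
  have h2 : x q ≤ x j := hx (by rw [Fin.le_def]; omega)
  have h3 : x r ≤ x l := hx (by rw [Fin.le_def]; omega)
  exact mul_le_mul h1 (mul_le_mul h2 h3 (hx0 _) (hx0 _)) (mul_nonneg (hx0 _) (hx0 _)) (hx0 _)

/-- After the weight of c moves to a, edges at c weigh nothing. Sparsity leaves room to replace them
by as many missing triples on the first n + 1 vertices, each of weight at least x_p x_q x_r; by
optimality this gain cannot exceed the loss from the shift. -/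
theorem Extremal.degree_mul_le (h : Extremal n E x) (ha : (a : ℕ) + 2 = k)
    (hc : (c : ℕ) + 1 = k) {p q r : Fin k} (hpq : (p : ℕ) + 1 = q) (hqr : (q : ℕ) + 1 = r)
    (hr : (r : ℕ) = n) (hk : n + 2 ≤ k) :
    #{e ∈ E | c ∈ e} * (x p * (x q * x r)) ≤ x c ^ 2 * pairWeight E a c x := by
  have hac : a ≠ c := fun hh => by rw [hh] at ha; omega
  set y := shiftWeight x a c (x c) with hy
  have hy1 : y ∈ stdSimplex ℝ (Fin k) :=
    shiftWeight_mem_stdSimplex h.mem hac (by linarith [h.pos a, h.pos c]) le_rfl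
  have hyc : y c = 0 := by rw [hy, shiftWeight_right x hac, sub_self]
  have hEy : edgeWeight E y = edgeWeight E x - x c ^ 2 * pairWeight E a c x := by
    rw [hy, edgeWeight_shiftWeight E x hac, h.linkWeight_eq, h.linkWeight_eq]
    ring
  set E₁ := {e ∈ E | c ∉ e} with hE₁
  have hE₁y : edgeWeight E₁ y = edgeWeight E y := by
    unfold edgeWeight
    rw [hE₁, sum_filter_of_ne]
    intro e _ hne hce
    exact hne (prod_eq_zero hce hyc)
  have hcard : #{e ∈ E | c ∈ e} + #E₁ = #E := card_filter_add_card_filter_not _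
  set P : Finset (Fin k) := Iic r with hP
  have hPc : #P = n + 1 := by rw [hP, Fin.card_Iic, hr]
  have hmiss : #{e ∈ E | c ∈ e} ≤ #(powersetCard 3 P \ E₁) := by
    have h1 := le_card_sdiff E₁ (powersetCard 3 P)
    rw [card_powersetCard, hPc] at h1
    have := h.sparse.card_le
    have hn3 : 2 ≤ 3 * n := by
      have : (p : ℕ) + 2 = n := by omega
      omega
    omega
  obtain ⟨R, hR, hRc⟩ := exists_subset_card_eq hmiss
  have hdisj : Disjoint E₁ R := by
    rw [disjoint_left]
    intro e he heR
    exact (mem_sdiff.1 (hR heR)).2 he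
  have hnew : Sparse n (E₁ ∪ R) := by
    refine ⟨fun e he => ?_, ?_⟩
    · rcases mem_union.1 he with he | he
      · exact h.sparse.card_of_mem e (mem_filter.1 he).1
      · exact (mem_powersetCard.1 (mem_sdiff.1 (hR he)).1).2
    · rw [card_union_of_disjoint hdisj, hRc, add_comm #E₁, hcard]
      exact h.sparse.card_le
  have hmax := h.max _ hnew y hy1
  have hsplit : edgeWeight (E₁ ∪ R) y = edgeWeight E₁ y + edgeWeight R y := sum_union hdisj
  have hRy : #{e ∈ E | c ∈ e} * (x p * (x q * x r)) ≤ edgeWeight R y := by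
    rw [← hRc, ← nsmul_eq_mul]
    refine card_nsmul_le_sum R _ _ fun f hf => ?_
    obtain ⟨hfP, hf3⟩ := mem_powersetCard.1 (mem_sdiff.1 (hR hf)).1
    have hfr : ∀ i ∈ f, i ≤ r := fun i hi => mem_Iic.1 (hfP hi)
    refine (prod_triple_ge h.anti h.mem.1 hpq hqr hf3 hfr).trans
      (prod_le_prod (fun i _ => h.mem.1 i) fun i hi => ?_)
    have hic : i ≠ c := fun hh => by
      have := hfr i hi
      rw [hh, Fin.le_def] at this
      omega
    by_cases hia : i = a
    · rw [hia, hy, shiftWeight_left]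
      linarith [h.pos c]
    · rw [hy, shiftWeight_of_ne x hia hic]
  linarith

theorem Extremal.large_support_false (h : Extremal n E x) (hn : 4 ≤ n) (hk : n + 2 ≤ k)
    (ha : (a : ℕ) + 2 = k) (hc : (c : ℕ) + 1 = k) (hcl : PairClosed E a c) : False := by
  have hac : a ≠ c := fun hh => by rw [hh] at ha; omega
  have hb := h.card_pairNbrs_add_four_le hn (by omega) hcl
  set b := #(pairNbrs E a c) with hbdef
  set o : Fin k := ⟨0, by omega⟩
  -- Indices start at 0: p, q, r are the three lightest of the first n + 1 vertices.
  set p : Fin k := ⟨n - 2, by omega⟩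
  set q : Fin k := ⟨n - 1, by omega⟩
  set r : Fin k := ⟨n, by omega⟩
  set u := x o with hu
  have hu0 : 0 < u := h.pos o
  have hmax : ∀ i, x i ≤ u := fun i => h.anti (Fin.le_def.2 (Nat.zero_le _))
  have hlast : ∀ i, x c ≤ x i := fun i => h.anti (Fin.le_def.2 (by omega))
  have hdeg := h.degree_mul_le ha hc (p := p) (q := q) (r := r) (by simp only [p, q]; omega)
    (by simp only [q, r]; omega) rfl hk
  have hpair := pairWeight_le h.sparse.card_of_mem hac hu0.le hmax
  rw [← hbdef] at hpair
  set D := #{e ∈ E | c ∈ e} with hD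
  have hDp : D * x p ≤ b * u := by
    have hc2 : 0 < x c ^ 2 := pow_pos (h.pos c) 2
    have h1 : x c ^ 2 ≤ x q * x r := by
      rw [pow_two]
      exact mul_le_mul (hlast q) (hlast r) (h.pos c).le (h.pos q).le
    have h2 := mul_le_mul_of_nonneg_left hpair hc2.le
    have h3 := mul_le_mul_of_nonneg_left h1 (mul_nonneg (Nat.cast_nonneg D) (h.pos p).le)
    refine le_of_mul_le_mul_left ?_ hc2
    linarith
  have hD0 : D ≠ 0 := fun hD0 => by
    have h1 := h.linkWeight_eq c
    rw [linkWeight, card_eq_zero.1 hD0, sum_empty] at h1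
    have h2 := (choose_div_le_cliqueLagrangian (show 0 < n by omega)).trans h.le
    have h3 : (0 : ℝ) < n.choose 3 / n ^ 3 := by
      have := Nat.choose_pos (show 3 ≤ n by omega)
      have : 0 < n := by omega
      positivity
    linarith
  have hb0 : 0 < b := Nat.pos_of_ne_zero fun hb0 => by
    rw [hb0, Nat.cast_zero, zero_mul] at hDp
    have : (0 : ℝ) < D * x p := mul_pos (by exact_mod_cast Nat.pos_of_ne_zero hD0) (h.pos p)
    linarith
  have hb0' : (0 : ℝ) < b := by exact_mod_cast hb0
  have hb' : (b : ℝ) + 4 ≤ n := by exact_mod_cast hb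
  have hk' : (n : ℝ) + 2 ≤ k := by exact_mod_cast hk
  have hn5 : (5 : ℝ) ≤ n := by exact_mod_cast (show 5 ≤ n by omega)
  have hdeg2 := le_two_mul_degree hcl (by omega) (by omega)
  rw [← hbdef, ← hD] at hdeg2
  have hxp : (2 * k - 3 - b) * x p ≤ 2 * u := by
    have h1 := mul_le_mul_of_nonneg_right hdeg2 (h.pos p).le
    refine le_of_mul_le_mul_left ?_ hb0'
    linarith
  have htail : ∑ i ∈ Ici p, x i ≤ u := by
    have h1 := sum_le_card_nsmul (Ici p) x (x p) fun i hi => h.anti (mem_Ici.1 hi)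
    rw [Fin.card_Ici, nsmul_eq_mul, Nat.cast_sub p.2.le,
      show ((p : ℕ) : ℝ) = n - 2 by simp only [p]; push_cast [show 2 ≤ n by omega]; ring] at h1
    -- The tail has k - n + 2 vertices, and b ≤ n - 4 gives 2(k - n + 2) ≤ 2k - 3 - b.
    have h2 : (2 * ((k : ℝ) - (n - 2))) * x p ≤ (2 * k - 3 - b) * x p :=
      mul_le_mul_of_nonneg_right (by linarith) (h.pos p).le
    linarith
  have hsum : ∑ i ∈ Iio p, x i + ∑ i ∈ Ici p, x i = 1 := by
    rw [← h.mem.2, ← sum_filter_add_sum_filter_not univ (· < p)]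
    congr 2
    · ext; simp
    · ext; simp
  have hcardp : ((#(Iio p) : ℕ) : ℝ) = n - 2 := by
    rw [Fin.card_Iio]
    simp only [p]
    push_cast [show 2 ≤ n by omega]
    ring
  have hhead : ∑ i ∈ Iio p, x i ≤ (n - 2) * u := by
    have h1 := sum_le_card_nsmul (Iio p) x u fun i _ => hmax i
    rwa [nsmul_eq_mul, hcardp] at h1
  have hsq : (∑ i ∈ Iio p, x i) ^ 2 ≤ (n - 2) * ∑ i, x i ^ 2 := by
    have h1 := sq_sum_le_card_mul_sum_sq (s := Iio p) (f := x)
    rw [hcardp] at h1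
    refine h1.trans (mul_le_mul_of_nonneg_left ?_ (by linarith))
    exact sum_le_sum_of_subset_of_nonneg (subset_univ _) fun i _ _ => sq_nonneg _
  have hou : u ≤ 1 := by
    rw [← h.mem.2]
    exact single_le_sum (fun i _ => h.mem.1 i) (mem_univ o)
  exact large_support_contradiction hn5 hou (by linarith) (by linarith) hsq
    (single_le_sum (f := fun i => x i ^ 2) (fun i _ => sq_nonneg _) (mem_univ o)) (h.cap hn o)

end LargeSupport

/-! ### Support of exactly n + 1 vertices -/

section CriticalSupport

variable {n : ℕ} {E : Finset (Finset (Fin (n + 1)))} {x : Fin (n + 1) → ℝ} {a c : Fin (n + 1)}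

/-- Merging c into a leaves n vertices and loses exactly the triples through both. -/
theorem esum_univ_le_add_mul (hx : x ∈ stdSimplex ℝ (Fin (n + 1))) (h : a ≠ c) :
    esum 3 univ x ≤ cliqueLagrangian n + x a * x c * ∑ i ∈ (univ.erase c).erase a, x i := by
  set s : Finset (Fin (n + 1)) := (univ.erase c).erase a with hs
  have hac : a ∈ univ.erase c := mem_erase.2 ⟨h, mem_univ a⟩
  have has : a ∉ s := notMem_erase a _
  have hcs : c ∉ insert a s := by
    rw [hs, insert_erase hac]
    exact notMem_erase c _
  have huniv : (univ : Finset (Fin (n + 1))) = insert c (insert a s) := by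
    rw [hs, insert_erase hac, insert_erase (mem_univ c)]
  have hcard : #(insert a s) = n := by
    rw [hs, insert_erase hac, card_erase_of_mem (mem_univ c)]
    simp
  set y := shiftWeight x a c (x c) with hy
  have hy1 : y ∈ stdSimplex ℝ (Fin (n + 1)) :=
    shiftWeight_mem_stdSimplex hx h (by linarith [hx.1 a, hx.1 c]) le_rfl
  have hyc : y c = 0 := by rw [hy, shiftWeight_right x h, sub_self]
  have hya : y a = x a + x c := shiftWeight_left x a c (x c)
  have hys : ∀ i ∈ s, y i = x i := fun i hi => by
    refine shiftWeight_of_ne x (ne_of_mem_of_not_mem hi has) (fun hh => hcs ?_) _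
    exact mem_insert_of_mem (hh ▸ hi)
  have hsum : ∑ i ∈ insert a s, y i = 1 := by
    rw [← hy1.2, huniv, sum_insert hcs, hyc, zero_add]
  have h1 := esum_le_cliqueLagrangian hcard.le hy1.1 hsum
  rw [esum_insert 2 has, hya, esum_congr hys, esum_congr hys] at h1
  rw [huniv, esum_insert 2 hcs, esum_insert 2 has, esum_insert 1 has, esum_one]
  linarith

/-- Let F be the non-edges and T the triples through a and c. Since E weighs at least λ([n]^(3)), F
weighs no more than T, and hence F \ T no more than T \ F; but F \ T has at least n/2 more members.
The witness b is |T \ F|. -/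
theorem Extremal.critical_count (h : Extremal n E x) (hn : 4 ≤ n) (ha : (a : ℕ) + 1 = n)
    (hc : (c : ℕ) = n) {u : ℝ} (hu : ∀ i, x i ≤ u) {p : Fin (n + 1)} (hp : (p : ℕ) + 3 = n) :
    ∃ b : ℕ, b ≤ #(pairNbrs E a c) ∧ (n + 2 * b) * x p ≤ 2 * b * u := by
  have hac : a ≠ c := fun hh => by rw [hh] at ha; omega
  set s : Finset (Fin (n + 1)) := (univ.erase c).erase a with hs
  have hmem : ∀ i, i ∈ s ↔ i ≠ a ∧ i ≠ c := fun i => by simp [hs]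
  set T : Finset (Finset (Fin (n + 1))) := s.image fun i => {i, a, c} with hT
  have hTcard : #T ≤ n - 1 := by
    refine card_image_le.trans ?_
    rw [hs, card_erase_of_mem (mem_erase.2 ⟨hac, mem_univ a⟩), card_erase_of_mem (mem_univ c)]
    simp
  have hTw : edgeWeight T x = x a * x c * ∑ i ∈ s, x i := by
    unfold edgeWeight
    rw [hT, sum_image, mul_sum]
    · refine sum_congr rfl fun i hi => ?_
      rw [prod_triple x ((hmem i).1 hi).1 ((hmem i).1 hi).2 hac]
      ring
    · intro i hi j _ hij
      have : i ∈ ({j, a, c} : Finset (Fin (n + 1))) := by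
        rw [← show ({i, a, c} : Finset (Fin (n + 1))) = {j, a, c} from hij]
        simp
      have hi' := (hmem i).1 hi
      simpa [hi'.1, hi'.2] using this
  set K : Finset (Finset (Fin (n + 1))) := powersetCard 3 univ with hK
  have hEK : E ⊆ K := fun e he => mem_powersetCard.2 ⟨subset_univ e, h.sparse.card_of_mem e he⟩
  have hKE : edgeWeight (K \ E) x + edgeWeight E x = edgeWeight K x := sum_sdiff hEK
  have hKx : edgeWeight K x ≤ cliqueLagrangian n + edgeWeight T x := by
    rw [hTw]
    exact esum_univ_le_add_mul h.mem hac
  set F := K \ E with hF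
  have hF1 : edgeWeight (F ∩ T) x + edgeWeight (F \ T) x = edgeWeight F x :=
    sum_inter_add_sum_sdiff F T _
  have hT1 : edgeWeight (T ∩ F) x + edgeWeight (T \ F) x = edgeWeight T x :=
    sum_inter_add_sum_sdiff T F _
  rw [inter_comm] at hT1
  have hle : edgeWeight (F \ T) x ≤ edgeWeight (T \ F) x := by
    have := h.le
    linarith
  have hFcard : #F + #E = (n + 1).choose 3 := by
    rw [hF, card_sdiff_add_card_eq_card hEK, hK, card_powersetCard]
    simp
  have hF2 : #(F \ T) + #(F ∩ T) = #F := card_sdiff_add_card_inter F T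
  have hT2 : #(T \ F) + #(T ∩ F) = #T := card_sdiff_add_card_inter T F
  rw [inter_comm] at hT2
  -- Here |F| ≥ (3n-2)/2 and |T| ≤ n - 1.
  have hcount : n + 2 * #(T \ F) ≤ 2 * #(F \ T) := by
    have := h.sparse.card_le
    omega
  have hTF : ∀ f ∈ T \ F, ∃ i ∈ pairNbrs E a c, {i, a, c} = f := fun f hf => by
    obtain ⟨hfT, hfF⟩ := mem_sdiff.1 hf
    obtain ⟨i, hi, rfl⟩ := mem_image.1 hfT
    refine ⟨i, mem_pairNbrs.2 ⟨((hmem i).1 hi).1, ((hmem i).1 hi).2, ?_⟩, rfl⟩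
    by_contra hE
    refine hfF (mem_sdiff.2 ⟨mem_powersetCard.2 ⟨subset_univ _, ?_⟩, hE⟩)
    exact card_eq_three.2 ⟨i, a, c, ((hmem i).1 hi).1, ((hmem i).1 hi).2, hac, rfl⟩
  refine ⟨#(T \ F), (card_le_card (t := (pairNbrs E a c).image fun i => {i, a, c})
    fun f hf => mem_image.2 (hTF f hf)).trans card_image_le, ?_⟩
  have hyz : 0 < x a * x c := mul_pos (h.pos a) (h.pos c)
  have hup : edgeWeight (T \ F) x ≤ #(T \ F) * (u * (x a * x c)) := by
    rw [← nsmul_eq_mul]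
    refine sum_le_card_nsmul _ _ _ fun f hf => ?_
    obtain ⟨i, hi, rfl⟩ := hTF f hf
    obtain ⟨hia, hic, -⟩ := mem_pairNbrs.1 hi
    rw [prod_triple x hia hic hac]
    exact mul_le_mul_of_nonneg_right (hu i) hyz.le
  have hlow : #(F \ T) * (x p * (x a * x c)) ≤ edgeWeight (F \ T) x := by
    rw [← nsmul_eq_mul]
    refine card_nsmul_le_sum _ _ _ fun f hf => ?_
    obtain ⟨hfF, hfT⟩ := mem_sdiff.1 hf
    have hf3 := (mem_powersetCard.1 (mem_sdiff.1 hfF).1).2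
    obtain ⟨i, j, l, hij, hjl, rfl⟩ := exists_lt_lt_of_card_eq_three hf3
    have hnot : ¬(j = a ∧ l = c) := fun ⟨hja, hlc⟩ => by
      refine hfT (mem_image.2 ⟨i, (hmem i).2 ⟨?_, ?_⟩, by rw [hja, hlc]⟩)
      · exact hja ▸ hij.ne
      · exact hlc ▸ (hij.trans hjl).ne
    rw [prod_triple x hij.ne (hij.trans hjl).ne hjl.ne]
    -- Only the pair (n-1, n) lies above n - 2, so outside T the middle index is at most n - 2 and
    -- the least at most n - 3 = p.
    have hja : (j : ℕ) + 2 ≤ n := by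
      by_contra! hlt
      rw [Fin.lt_def] at hjl
      exact hnot ⟨Fin.ext (by omega), Fin.ext (by omega)⟩
    rw [Fin.lt_def] at hij hjl
    have h1 : x p ≤ x i := h.anti (by rw [Fin.le_def]; omega)
    have h2 : x a ≤ x j := h.anti (by rw [Fin.le_def]; omega)
    have h3 : x c ≤ x l := h.anti (by rw [Fin.le_def]; omega)
    exact mul_le_mul h1 (mul_le_mul h2 h3 (h.pos _).le (h.pos _).le) hyz.le (h.pos _).le
  have hcount' : (n : ℝ) + 2 * #(T \ F) ≤ 2 * #(F \ T) := by exact_mod_cast hcount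
  have h4 := mul_le_mul_of_nonneg_right hcount' (mul_pos (h.pos p) hyz).le
  refine le_of_mul_le_mul_right ?_ hyz
  linarith

theorem Extremal.critical_support_false (h : Extremal n E x) (hn : 4 ≤ n) (ha : (a : ℕ) + 1 = n)
    (hc : (c : ℕ) = n) (hcl : PairClosed E a c) : False := by
  have hbn := h.card_pairNbrs_add_four_le hn le_rfl hcl
  set o : Fin (n + 1) := 0
  set p : Fin (n + 1) := ⟨n - 3, by omega⟩
  set u := x o with hu
  have hu0 : 0 < u := h.pos o
  have hmax : ∀ i, x i ≤ u := fun i => h.anti (Fin.zero_le i)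
  obtain ⟨b, hb, hbu⟩ := h.critical_count hn ha hc hmax (p := p) (by simp only [p]; omega)
  have hb0 : 0 < b := Nat.pos_of_ne_zero fun hb0 => by
    rw [hb0, Nat.cast_zero, mul_zero, add_zero, zero_mul] at hbu
    have : (0 : ℝ) < n * x p := mul_pos (by exact_mod_cast (by omega : 0 < n)) (h.pos p)
    linarith
  have hn5 : (5 : ℝ) ≤ n := by exact_mod_cast (show 5 ≤ n by omega)
  have hb4 : (b : ℝ) + 4 ≤ n := by exact_mod_cast (show b + 4 ≤ n by omega)
  have hpu : 0 ≤ u - x p := by linarith [hmax p]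
  have hd : n * u ≤ (3 * n - 8) * (u - x p) := by
    have := mul_le_mul_of_nonneg_right (show (n : ℝ) + 2 * b ≤ 3 * n - 8 by linarith) hpu
    linarith
  have hcardp : ((#(Ici p) : ℕ) : ℝ) = 4 := by
    rw [Fin.card_Ici, show n + 1 - (p : ℕ) = 4 by simp only [p]; omega]
    norm_num
  have hdiff : ∀ i ∈ Ici p, u - x p ≤ u - x i := fun i hi => by
    linarith [h.anti (mem_Ici.1 hi)]
  have hsum : 4 * (u - x p) ≤ (n + 1) * u - 1 := by
    have h1 := card_nsmul_le_sum (Ici p) (fun i => u - x i) _ hdiff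
    rw [nsmul_eq_mul, hcardp] at h1
    refine (h1.trans (sum_le_sum_of_subset_of_nonneg (subset_univ _)
      fun i _ _ => sub_nonneg.2 (hmax i))).trans_eq ?_
    rw [sum_sub_distrib, h.mem.2]
    simp
  have hQ : 2 * u - (n + 1) * u ^ 2 + 4 * (u - x p) ^ 2 ≤ ∑ i, x i ^ 2 := by
    have h1 := card_nsmul_le_sum (Ici p) (fun i => (u - x i) ^ 2) ((u - x p) ^ 2)
      fun i hi => pow_le_pow_left₀ hpu (hdiff i hi) 2
    rw [nsmul_eq_mul, hcardp] at h1
    have h2 := h1.trans (sum_le_sum_of_subset_of_nonneg (subset_univ _)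
      fun i _ _ => sq_nonneg (u - x i))
    have h3 : ∑ i, (u - x i) ^ 2 = (n + 1) * u ^ 2 - 2 * u + ∑ i, x i ^ 2 := by
      simp_rw [sub_sq]
      rw [sum_add_distrib, sum_sub_distrib, ← mul_sum, h.mem.2]
      simp
    linarith
  have hQ1 : 1 ≤ ((n : ℝ) + 1) * ∑ i, x i ^ 2 := by
    have h1 := sq_sum_le_card_mul_sum_sq (s := univ) (f := x)
    rw [h.mem.2] at h1
    simpa using h1
  have hou : u ≤ 1 := by
    rw [← h.mem.2]
    exact single_le_sum (fun i _ => h.mem.1 i) (mem_univ o)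
  exact critical_support_contradiction hn5 hu0 hou hd hsum hQ hQ1
    (single_le_sum (f := fun i => x i ^ 2) (fun i _ => sq_nonneg _) (mem_univ o)) (h.cap hn o)

end CriticalSupport

/-! ### Reduction to extremal pairs with full support -/

section Reduction

theorem Extremal.false {k n : ℕ} {E : Finset (Finset (Fin k))} {x : Fin k → ℝ}
    (h : Extremal n E x) (hn : 4 ≤ n) (hk : n < k) : False := by
  obtain ⟨F, hF, hcl⟩ := h.exists_pairClosed (a := ⟨k - 2, by omega⟩) (c := ⟨k - 1, by omega⟩)
    (by simp only; omega) (by simp only; omega)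
  rcases (show n + 1 ≤ k from hk).eq_or_lt with rfl | hlt
  · exact hF.critical_support_false hn (by simp only; omega) (by simp) hcl
  · exact hF.large_support_false hn hlt (by simp only; omega) (by simp only; omega) hcl

/-- A weighting can be restricted to its support, listed in decreasing order of the weights. -/
theorem exists_sorted_support {V : Type*} [Fintype V] (x : V → ℝ) (hx : ∀ v, 0 ≤ x v) :
    ∃ (k : ℕ) (g : Fin k ↪ V), (∀ i, 0 < x (g i)) ∧ Antitone (x ∘ g) ∧
      ∀ v, v ∉ Set.range g → x v = 0 := by
  classical
  set S : Finset V := {v | x v ≠ 0} with hS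
  set f : Fin #S → V := fun i => S.equivFin.symm i with hf
  have hfinj : Function.Injective f := Subtype.val_injective.comp S.equivFin.symm.injective
  set σ := Tuple.sort (fun i => -x (f i)) with hσ
  refine ⟨#S, ⟨f ∘ σ, hfinj.comp σ.injective⟩, fun i => ?_, fun i j hij => ?_, fun v hv => ?_⟩
  · have : f (σ i) ∈ S := (S.equivFin.symm (σ i)).2
    exact lt_of_le_of_ne (hx _) (by simpa [hS, eq_comm] using this)
  · have := Tuple.monotone_sort (fun i => -x (f i)) hij
    simpa [hσ] using this
  · by_contra h
    have hvS : v ∈ S := by simp [hS, h]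
    refine hv ⟨σ.symm (S.equivFin ⟨v, hvS⟩), ?_⟩
    simp [hf]

theorem comp_mem_stdSimplex {α β : Type*} [Fintype α] [Fintype β] {g : α ↪ β} {x : β → ℝ}
    (hx1 : x ∈ stdSimplex ℝ β) (hx : ∀ v, v ∉ Set.range g → x v = 0) : x ∘ g ∈ stdSimplex ℝ α := by
  refine ⟨fun i => hx1.1 _, ?_⟩
  rw [← hx1.2, ← sum_subset (subset_univ (univ.map g)), sum_map]
  · rfl
  · intro v _ hv
    exact hx v (by simpa using hv)

/-- The family induced on the image of an embedding. -/
def comapEdges {α β : Type*} [Fintype α] [DecidableEq α] [DecidableEq β] (g : α ↪ β)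
    (E : Finset (Finset β)) : Finset (Finset α) :=
  {f | f.map g ∈ E}

variable {α β : Type*} [Fintype α] [DecidableEq α] [DecidableEq β] {g : α ↪ β}
  {E : Finset (Finset β)} {x : β → ℝ}

theorem mem_comapEdges {f : Finset α} : f ∈ comapEdges g E ↔ f.map g ∈ E := by
  simp [comapEdges]

theorem card_comapEdges_le : #(comapEdges g E) ≤ #E :=
  card_le_card_of_injOn (fun f => f.map g) (fun _ hf => mem_comapEdges.1 hf)
    (map_injective g).injOn

theorem card_of_mem_comapEdges {r : ℕ} (hE : ∀ e ∈ E, #e = r) :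
    ∀ f ∈ comapEdges g E, #f = r := fun f hf => by
  rw [← card_map g]
  exact hE _ (mem_comapEdges.1 hf)

theorem Sparse.comapEdges {n : ℕ} (hE : Sparse n E) : Sparse n (comapEdges g E) :=
  ⟨card_of_mem_comapEdges hE.card_of_mem, by
    have := card_comapEdges_le (g := g) (E := E)
    have := hE.card_le
    omega⟩

theorem edgeWeight_comapEdges (hx : ∀ v, v ∉ Set.range g → x v = 0) :
    edgeWeight (comapEdges g E) (x ∘ g) = edgeWeight E x := by
  have h : ∀ f : Finset α, ∏ i ∈ f, (x ∘ g) i = ∏ v ∈ f.map g, x v := fun f => by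
    rw [prod_map]
    rfl
  unfold edgeWeight
  simp_rw [h]
  rw [← sum_image (s := _root_.comapEdges g E) (g := fun f => f.map g)
    (f := fun e => ∏ v ∈ e, x v) (map_injective g).injOn]
  refine sum_subset (fun e he => ?_) fun e he hne => ?_
  · obtain ⟨f, hf, rfl⟩ := mem_image.1 he
    exact mem_comapEdges.1 hf
  · by_contra hprod
    have hr : ∀ v ∈ e, v ∈ Set.range g := fun v hv => by
      by_contra hvr
      exact hprod (prod_eq_zero hv (hx v hvr))
    obtain ⟨f, rfl⟩ : ∃ f : Finset α, f.map g = e := by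
      obtain ⟨f, -, hf⟩ := subset_map_iff.1 (show e ⊆ univ.map g from fun v hv => by
        obtain ⟨i, rfl⟩ := hr v hv
        simp)
      exact ⟨f, hf.symm⟩
    exact hne (mem_image_of_mem _ (mem_comapEdges.2 he))

/-- Strong induction on k: a global optimum over sparse families either has smaller support or is
`Extremal`. This non-strict bound makes any sparse family reaching λ([n]^(3)) globally optimal, as
the strict version needs. -/
theorem edgeWeight_le_cliqueLagrangian {k n : ℕ} (hn : 4 ≤ n) {E : Finset (Finset (Fin k))}
    (hE : Sparse n E) {x : Fin k → ℝ} (hx : x ∈ stdSimplex ℝ (Fin k)) :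
    edgeWeight E x ≤ cliqueLagrangian n := by
  induction k using Nat.strong_induction_on with
  | _ k ih =>
  rcases le_or_gt k n with hk | hk
  · refine le_trans (edgeWeight_mono (F := powersetCard 3 univ) (fun e he =>
      mem_powersetCard.2 ⟨subset_univ e, hE.card_of_mem e he⟩) hx.1) ?_
    exact esum_le_cliqueLagrangian (by simpa using hk) hx.1 hx.2
  by_contra! hlt
  have hmaxE : ∀ E' : Finset (Finset (Fin k)), ∃ y ∈ stdSimplex ℝ (Fin k),
      ∀ z ∈ stdSimplex ℝ (Fin k), edgeWeight E' z ≤ edgeWeight E' y := fun E' => by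
    have hc : Continuous (edgeWeight E') := by
      unfold edgeWeight
      fun_prop
    obtain ⟨y, hy, hmax⟩ := (isCompact_stdSimplex ℝ (Fin k)).exists_isMaxOn ⟨x, hx⟩
      hc.continuousOn
    exact ⟨y, hy, fun z hz => hmax hz⟩
  choose y hy hymax using hmaxE
  obtain ⟨F, hF, hFmax⟩ := Set.exists_max_image {E' : Finset (Finset (Fin k)) | Sparse n E'}
    (fun E' => edgeWeight E' (y E')) (Set.toFinite _) ⟨E, hE⟩
  have hmax : ∀ E', Sparse n E' → ∀ z ∈ stdSimplex ℝ (Fin k),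
      edgeWeight E' z ≤ edgeWeight F (y F) := fun E' hE' z hz =>
    (hymax E' z hz).trans (hFmax E' hE')
  have hFlt : cliqueLagrangian n < edgeWeight F (y F) := hlt.trans_le (hmax E hE x hx)
  obtain ⟨j, g, hpos, hanti, hzero⟩ := exists_sorted_support (y F) (hy F).1
  have hjk : j ≤ k := by simpa using Fintype.card_le_of_embedding g
  have hw := edgeWeight_comapEdges (E := F) hzero
  have hmem := comp_mem_stdSimplex (hy F) hzero
  rcases hjk.lt_or_eq with hj | rfl
  · have := ih j hj (Sparse.comapEdges (g := g) hF) hmem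
    linarith
  · exact Extremal.false ⟨Sparse.comapEdges hF, hmem, hpos, hanti, by rw [hw]; exact hFlt.le,
      fun E' hE' z hz => by rw [hw]; exact hmax E' hE' z hz⟩ hn hk

theorem edgeWeight_lt_cliqueLagrangian {V : Type*} [Fintype V] [DecidableEq V] {n : ℕ}
    (hn : 4 ≤ n) {E : Finset (Finset V)} (hE : Sparse n E)
    (hclique : ¬∃ S : Finset V, #S = n ∧ ∀ e : Finset V, e ⊆ S → #e = 3 → e ∈ E) {x : V → ℝ}
    (hx : x ∈ stdSimplex ℝ V) : edgeWeight E x < cliqueLagrangian n := by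
  obtain ⟨k, g, hpos, hanti, hzero⟩ := exists_sorted_support x hx.1
  rw [← edgeWeight_comapEdges (E := E) hzero]
  have hmem := comp_mem_stdSimplex hx hzero
  have hE' := Sparse.comapEdges (g := g) hE
  have hsub : comapEdges g E ⊆ powersetCard 3 univ := fun e he =>
    mem_powersetCard.2 ⟨subset_univ e, hE'.card_of_mem e he⟩
  rcases lt_trichotomy k n with hk | rfl | hk
  · exact (edgeWeight_mono hsub hmem.1).trans_lt
      (esum_lt_cliqueLagrangian (by omega) (by simpa using hk) hmem.1 hmem.2)
  · refine lt_of_lt_of_le ?_ (esum_univ_le_cliqueLagrangian hmem)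
    obtain ⟨f, hf3, hf⟩ : ∃ f : Finset (Fin k), #f = 3 ∧ f ∉ comapEdges g E := by
      by_contra! hall
      refine hclique ⟨univ.map g, by simp, fun e he he3 => ?_⟩
      obtain ⟨f, -, rfl⟩ := subset_map_iff.1 he
      exact mem_comapEdges.1 (hall f (by rwa [card_map] at he3))
    exact sum_lt_sum_of_subset hsub (mem_powersetCard.2 ⟨subset_univ f, hf3⟩) hf
      (prod_pos fun i _ => hpos i) fun e _ _ => prod_nonneg fun i _ => hmem.1 i
  · by_contra! hle
    exact Extremal.false ⟨hE', hmem, hpos, hanti, hle, fun E' hE' z hz =>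
      (edgeWeight_le_cliqueLagrangian hn hE' hz).trans hle⟩ hn hk

end Reduction

/-! ### The theorem -/

theorem mainTheorem1 {V : Type*} [Fintype V] (t m : ℕ)
    (hlower : (Nat.choose (t - 1) 3 : ℝ) ≤ (m : ℝ))
    (hupper : (m : ℝ) ≤
      (Nat.choose (t - 1) 3 : ℝ) + (Nat.choose (t - 2) 2 : ℝ) - ((t : ℝ) - 1) / 2)
    (G : RGraph 3 V) (hm : G.edges.card = m) (hclique : ¬ G.ContainsClique (t - 1)) :
    G.lagrangian < (RGraph.complete 3 (Fin (t - 1))).lagrangian := by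
  classical
  -- For t ≤ 1 the truncated t - 1 is 0 and the empty set is a clique; for t = 2, 3, 4 the bounds on
  -- m are incompatible.
  have ht : 5 ≤ t := by
    by_contra! hlt
    interval_cases t
    · exact hclique ⟨∅, rfl, fun e he he3 => by simp [subset_empty.1 he] at he3⟩
    · exact hclique ⟨∅, rfl, fun e he he3 => by simp [subset_empty.1 he] at he3⟩
    all_goals
      norm_num [Nat.choose] at hlower hupper
      first | linarith | (have : (1 : ℝ) ≤ m := by exact_mod_cast hlower); linarith
  obtain ⟨n, rfl⟩ : ∃ n, t = n + 2 := ⟨t - 2, by omega⟩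
  rw [show n + 2 - 1 = n + 1 by omega] at *
  rw [show n + 2 - 2 = n by omega] at hupper
  have hsparse : Sparse (n + 1) G.edges := by
    refine ⟨G.card_of_mem, ?_⟩
    rw [Nat.choose_succ_succ' (n + 1) 2, Nat.choose_succ_succ' n 1, Nat.choose_one_right, hm]
    have : (2 * m + 3 * (n + 1) : ℝ)
        ≤ 2 * (n + n.choose 2 + (n + 1).choose 3) + 2 := by
      push_cast at hupper
      linarith
    exact_mod_cast this
  have hne : Nonempty V := by
    have hpos := Nat.choose_pos (show 3 ≤ n + 1 by omega)
    have hlow : (n + 1).choose 3 ≤ #G.edges := by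
      rw [hm]
      exact_mod_cast hlower
    obtain ⟨e, he⟩ := card_pos.1 (by omega : 0 < #G.edges)
    obtain ⟨v, -⟩ := card_pos.1 (by rw [G.card_of_mem e he]; omega : 0 < #e)
    exact ⟨v⟩
  obtain ⟨x, hx, hxG⟩ := (RGraph.lagrangian_isGreatest G).1
  rw [← hxG]
  exact edgeWeight_lt_cliqueLagrangian (by omega) hsparse hclique hx
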